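/- Let $M$ be a Riemann surface, i.e. a smooth $2$-dimensional manifold with a smooth bundle map $J:TM\to TM$, $J^2=-I$; for a $1$-form $\omega$ on $M$ put $*\omega:=\omega\circ J$. Regard $\mathbb{H}^2$ as a right quaternionic vector space, let $\mathrm{End}(\mathbb{H}^2)$ be its quaternionic linear endomorphisms, $\mathcal{Z}=\{S\in\mathrm{End}(\mathbb{H}^2)\mid S^2=-I\}$, and $\langle A,B\rangle=\frac18\,\mathrm{tr}_{\mathbb{R}}(AB)$. Let $L\subset H=M\times\mathbb{H}^2$ be a smooth quaternionic line subbundle, with derivative $\delta\in\Omega^1(\mathrm{Hom}(L,H/L))$ defined by $\delta_p(X)\psi(p)=d_p\psi(X)\bmod L_p$ for smooth local sections $\psi$ of $L$. Suppose that $L$ is an immersed holomorphic curve in $\mathbb{H}P^1$: each $\delta_p$ is injective on $T_pM$, and there is a smooth quaternionic linear bundle endomorphism $\mathcal{J}$ of $L$ with $\mathcal{J}^2=-I$ and $*\delta=\delta\mathcal{J}$. Let $S:M\to\mathcal{Z}$ be the mean curvature sphere of $L$, i.e. the smooth map $S:M\to\mathcal{Z}$ such that $$SL=L,\qquad dS\,L\subset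 L,\qquad *\delta=\delta\circ S=S\circ\delta,\qquad Q|_L=0,\quad\text{where } Q=\tfrac14(S\,dS-*dS)$$ (in $S\circ\delta$, $S$ denotes the endomorphism induced on $H/L$). Then $S$ is conformal with respect to the trace form: for all $p\in M$ and $X\in T_pM$, $$\langle dS(X),dS(X)\rangle=\langle *dS(X),*dS(X)\rangle,\qquad \langle dS(X),*dS(X)\rangle=0 .$$ -/

import Mathlib

open scoped Quaternion Manifold ContDiff Topology

noncomputable section

namespace QuaternionicCurve

/-- The space `ℍ²`. Its quaternionic (right) scalar multiplication `v λ` is the action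
`MulOpposite.op λ • v` of the opposite algebra `ℍᵐᵒᵖ`. -/
abbrev H2 : Type := Fin 2 → ℍ[ℝ]

/-- `End(ℍ²)`: the quaternionic linear endomorphisms of the right vector space `ℍ²`. -/
abbrev EndH2 : Type := Module.End (ℍ[ℝ])ᵐᵒᵖ H2

/-- The inclusion of `End(ℍ²)` into the (normed) space of real endomorphisms of `ℍ²`. -/
def toReal (A : EndH2) : H2 →L[ℝ] H2 :=
  LinearMap.toContinuousLinearMap (A.restrictScalars ℝ)

/-- The set `𝒵 = {S ∈ End(ℍ²) | S² = -I}` of oriented 2-spheres in `ℍP¹`. -/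
def Z : Set EndH2 := {S | S * S = -1}

/-- The trace form `⟨A, B⟩ = (1/8) tr_ℝ (A B)`. -/
def traceForm (A B : H2 →L[ℝ] H2) : ℝ :=
  (1 / 8 : ℝ) * LinearMap.trace ℝ H2 ((A.comp B : H2 →L[ℝ] H2) : H2 →ₗ[ℝ] H2)

section Surface

variable {M : Type*} [TopologicalSpace M] [ChartedSpace (EuclideanSpace ℝ (Fin 2)) M]

variable (M) in
/-- A complex structure on a surface: a smooth bundle map `J : TM → TM` with `J² = -I`.
A Riemann surface is a smooth 2-dimensional manifold with such a structure. -/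
structure ComplexStructure [IsManifold (𝓡 2) ∞ M] where
  J : (p : M) → TangentSpace (𝓡 2) p →L[ℝ] TangentSpace (𝓡 2) p
  sq : ∀ p X, J p (J p X) = -X
  smooth : ContMDiff (𝓡 2).tangent (𝓡 2).tangent ∞
    (fun v : TangentBundle (𝓡 2) M => (⟨v.proj, J v.proj v.snd⟩ : TangentBundle (𝓡 2) M))

variable (M) in
/-- A smooth quaternionic line subbundle `L` of the trivial bundle `H = M × ℍ²`. -/
structure LineSubbundle where
  fiber : M → Submodule (ℍ[ℝ])ᵐᵒᵖ H2
  exists_frame : ∀ p, ∃ U : Set M, IsOpen U ∧ p ∈ U ∧ ∃ φ : M → H2,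
    ContMDiffOn (𝓡 2) 𝓘(ℝ, H2) ∞ φ U ∧
      ∀ q ∈ U, φ q ≠ 0 ∧ fiber q = Submodule.span (ℍ[ℝ])ᵐᵒᵖ {φ q}

namespace LineSubbundle

variable (L : LineSubbundle M)

/-- A smooth local frame of `L` near `p`. -/
def frame (p : M) : M → H2 := (L.exists_frame p).choose_spec.2.2.choose

theorem frame_spec (p : M) : ∃ U : Set M, IsOpen U ∧ p ∈ U ∧
    ContMDiffOn (𝓡 2) 𝓘(ℝ, H2) ∞ (L.frame p) U ∧
      ∀ q ∈ U, L.frame p q ≠ 0 ∧ L.fiber q = Submodule.span (ℍ[ℝ])ᵐᵒᵖ {L.frame p q} :=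
  ⟨_, (L.exists_frame p).choose_spec.1, (L.exists_frame p).choose_spec.2.1,
    (L.exists_frame p).choose_spec.2.2.choose_spec⟩

theorem frame_ne (p : M) : L.frame p p ≠ 0 := by
  obtain ⟨U, -, hp, -, h⟩ := L.frame_spec p
  exact (h p hp).1

theorem fiber_eq (p : M) : L.fiber p = Submodule.span (ℍ[ℝ])ᵐᵒᵖ {L.frame p p} := by
  obtain ⟨U, -, hp, -, h⟩ := L.frame_spec p
  exact (h p hp).2

/-- The quaternionic linear coordinate on `L_p` defined by the frame. -/
def coord (p : M) : L.fiber p →ₗ[(ℍ[ℝ])ᵐᵒᵖ] (ℍ[ℝ])ᵐᵒᵖ :=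
  (LinearEquiv.toSpanNonzeroSingleton (ℍ[ℝ])ᵐᵒᵖ H2 (L.frame p p) (L.frame_ne p)).symm.toLinearMap
    ∘ₗ (LinearEquiv.ofEq _ _ (L.fiber_eq p)).toLinearMap

/-- The derivative `δ ∈ Ω¹(Hom(L, H/L))` of `L`. It is the quaternionic linear map with
`δ_p(X) φ(p) = d_pφ(X) mod L_p` for the frame `φ`; by `delta_apply` below,
`δ_p(X) ψ(p) = d_pψ(X) mod L_p` then holds for every local section `ψ` of `L`. -/
def delta (p : M) :
    TangentSpace (𝓡 2) p →ₗ[ℝ] (L.fiber p →ₗ[(ℍ[ℝ])ᵐᵒᵖ] (H2 ⧸ L.fiber p)) where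
  toFun X := LinearMap.toSpanSingleton (ℍ[ℝ])ᵐᵒᵖ (H2 ⧸ L.fiber p)
    ((L.fiber p).mkQ (mvfderiv (𝓡 2) (L.frame p) p X)) ∘ₗ L.coord p
  map_add' X Y := by
    ext v
    simp
  map_smul' r X := by
    ext v
    have h : (L.fiber p).mkQ (r • mvfderiv (𝓡 2) (L.frame p) p X)
      = r • (L.fiber p).mkQ (mvfderiv (𝓡 2) (L.frame p) p X) := rfl
    simp only [map_smul, h, LinearMap.comp_apply, LinearMap.toSpanSingleton_apply,
      LinearMap.smul_apply, RingHom.id_apply]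
    rw [smul_comm]

theorem delta_apply (p : M) (X : TangentSpace (𝓡 2) p) (ψ : M → H2)
    (hψ : MDifferentiableAt (𝓡 2) 𝓘(ℝ, H2) ψ p) (hL : ∀ᶠ q in 𝓝 p, ψ q ∈ L.fiber q) :
    L.delta p X ⟨ψ p, hL.self_of_nhds⟩ = (L.fiber p).mkQ (mvfderiv (𝓡 2) ψ p X) := by
  obtain ⟨U, hU, hp, hφ, hspan⟩ := L.frame_spec p
  have hφd : MDifferentiableAt (𝓡 2) 𝓘(ℝ, H2) (L.frame p) p :=
    (hφ.contMDiffAt (hU.mem_nhds hp)).mdifferentiableAt (by simp)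
  obtain ⟨i, hi⟩ : ∃ i, L.frame p p i ≠ 0 := Function.ne_iff.mp (L.frame_ne p)
  have hev : ∀ k, Differentiable ℝ (fun v : H2 => v k) := fun k => by fun_prop
  have hφi : ∀ k, MDifferentiableAt (𝓡 2) 𝓘(ℝ, ℍ[ℝ]) (fun q => L.frame p q k) p := fun k =>
    (hev k).comp_mdifferentiableAt hφd
  have hψi : ∀ k, MDifferentiableAt (𝓡 2) 𝓘(ℝ, ℍ[ℝ]) (fun q => ψ q k) p := fun k =>
    (hev k).comp_mdifferentiableAt hψ
  have hcoord : ∀ (f : M → H2), MDifferentiableAt (𝓡 2) 𝓘(ℝ, H2) f p → ∀ k,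
      mvfderiv (𝓡 2) f p X k = mvfderiv (𝓡 2) (fun q => f q k) p X := by
    intro f hf k
    have h := (ContinuousLinearMap.proj (R := ℝ) (φ := fun _ : Fin 2 => ℍ[ℝ]) k).hasMFDerivAt
      (x := f p) |>.comp p hf.hasMFDerivAt
    exact (congrArg (fun A => A X) h.mfderiv).symm
  set l : M → ℍ[ℝ] := fun q => (L.frame p q i)⁻¹ * ψ q i with hl
  have hinv : MDifferentiableAt (𝓡 2) 𝓘(ℝ, ℍ[ℝ]) (fun q => (L.frame p q i)⁻¹) p :=
    DifferentiableAt.comp_mdifferentiableAt (g := fun a : ℍ[ℝ] => a⁻¹)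
      (hasFDerivAt_inv' hi).differentiableAt (hφi i)
  have hld : MDifferentiableAt (𝓡 2) 𝓘(ℝ, ℍ[ℝ]) l p := MDifferentiableAt.mul hinv (hψi i)
  have hmem : ∀ q ∈ U, ψ q ∈ L.fiber q → ∀ k, ψ q k = L.frame p q k * l q ∨
      L.frame p q i = 0 := by
    intro q hq hm k
    rw [(hspan q hq).2] at hm
    obtain ⟨a, ha⟩ := Submodule.mem_span_singleton.mp hm
    by_cases h0 : L.frame p q i = 0
    · exact Or.inr h0
    · left
      have h1 : ∀ k, ψ q k = L.frame p q k * a.unop := fun k => (congrFun ha k).symm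
      rw [hl, h1 k]
      simp only [h1 i, inv_mul_cancel_left₀ h0]
  have hval : ψ p = MulOpposite.op (l p) • L.frame p p :=
    funext fun k => (hmem p hp hL.self_of_nhds k).resolve_right hi
  have hder : mvfderiv (𝓡 2) ψ p X = MulOpposite.op (l p) • mvfderiv (𝓡 2) (L.frame p) p X
      + MulOpposite.op (mvfderiv (𝓡 2) l p X) • L.frame p p := by
    funext k
    have hne : ∀ᶠ q in 𝓝 p, L.frame p q i ≠ 0 := (hφi i).continuousAt.eventually_ne hi
    have heq : (fun q => ψ q k) =ᶠ[𝓝 p] (fun q => L.frame p q k) * l := by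
      filter_upwards [hL, hU.mem_nhds hp, hne] with q h1 h2 h3
      exact (hmem q h2 h1 k).resolve_right h3
    have h := ((hφi k).hasMFDerivAt.mul' hld.hasMFDerivAt).congr_of_eventuallyEq heq
    have h' : mvfderiv (𝓡 2) (fun q => ψ q k) p X = L.frame p p k * mvfderiv (𝓡 2) l p X
        + mvfderiv (𝓡 2) (fun q => L.frame p q k) p X * l p :=
      congrArg (fun A => A X) h.mfderiv
    rw [hcoord ψ hψ k, h', add_comm, Pi.add_apply, Pi.smul_apply, Pi.smul_apply,
      hcoord _ hφd k]
    rfl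
  have hc : L.coord p ⟨ψ p, hL.self_of_nhds⟩ = MulOpposite.op (l p) := by
    refine (LinearEquiv.symm_apply_eq _).mpr ?_
    ext1
    exact hval
  have hφm : L.frame p p ∈ L.fiber p := by
    rw [L.fiber_eq p]; exact Submodule.mem_span_singleton_self _
  change L.coord p ⟨ψ p, hL.self_of_nhds⟩ • (L.fiber p).mkQ (mvfderiv (𝓡 2) (L.frame p) p X) = _
  rw [hc, hder, map_add, map_smul, map_smul, show (L.fiber p).mkQ (L.frame p p) = 0 from (Submodule.Quotient.mk_eq_zero _).mpr hφm]
  simp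

end LineSubbundle

variable [IsManifold (𝓡 2) ∞ M] (C : ComplexStructure M) (L : LineSubbundle M)

/-- `L` is a holomorphic curve in `ℍP¹`: there is a complex structure `𝒥` on `L`, i.e. a smooth
section of `End(L)` with `𝒥² = -I`, such that `*δ = δ 𝒥`, where `*δ(X) = δ(J X)`. Smoothness of
`𝒥` means that it maps smooth local sections of `L` to smooth local sections. -/
def IsHolomorphicCurve : Prop :=
  ∃ 𝒥 : (p : M) → Module.End (ℍ[ℝ])ᵐᵒᵖ (L.fiber p),
    (∀ U : Set M, IsOpen U → ∀ ψ : (q : M) → L.fiber q,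
      ContMDiffOn (𝓡 2) 𝓘(ℝ, H2) ∞ (fun q => (ψ q : H2)) U →
      ContMDiffOn (𝓡 2) 𝓘(ℝ, H2) ∞ (fun q => (𝒥 q (ψ q) : H2)) U) ∧
    (∀ p, 𝒥 p * 𝒥 p = -1) ∧
    ∀ p X, L.delta p (C.J p X) = L.delta p X ∘ₗ 𝒥 p

/-- `L` is immersed: its derivative `δ` is injective. -/
def IsImmersed : Prop := ∀ p, Function.Injective (L.delta p)

/-- The differential `dS` of a map `S : M → End(ℍ²)`. -/
def dEnd (S : M → EndH2) (p : M) : TangentSpace (𝓡 2) p →L[ℝ] (H2 →L[ℝ] H2) :=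
  mvfderiv (𝓡 2) (fun q => toReal (S q)) p

/-- `*dS`, where `*ω = ω ∘ J`. -/
def starDEnd (S : M → EndH2) (p : M) : TangentSpace (𝓡 2) p →L[ℝ] (H2 →L[ℝ] H2) :=
  (dEnd S p).comp (C.J p)

/-- The Hopf field `Q = (1/4)(S dS - *dS)` of a complex structure `S` on `H = M × ℍ²`. -/
def hopfQ (S : M → EndH2) (p : M) (X : TangentSpace (𝓡 2) p) : H2 →L[ℝ] H2 :=
  (1 / 4 : ℝ) • ((toReal (S p)).comp (dEnd S p X) - starDEnd C S p X)

/-- `d''ψ = (1/2)(dψ + S *dψ)`, the antilinear part of the differential of `ψ : M → ℍ²`. -/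
def dBar (S : M → EndH2) (ψ : M → H2) (p : M) (X : TangentSpace (𝓡 2) p) : H2 :=
  (1 / 2 : ℝ) • (mvfderiv (𝓡 2) ψ p X + S p (mvfderiv (𝓡 2) ψ p (C.J p X)))

/-- `Q` is the part of `d''` that anticommutes with `S`: one has `d'' = ∂bar + Q` with
`∂bar ψ = (1/2)(d''ψ - S d''(Sψ))`. -/
theorem dBar_eq (S : M → EndH2) (p : M) (X : TangentSpace (𝓡 2) p) (ψ : M → H2)
    (hZ : S p ∈ Z)
    (hS : MDifferentiableAt (𝓡 2) 𝓘(ℝ, H2 →L[ℝ] H2) (fun q => toReal (S q)) p)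
    (hψ : MDifferentiableAt (𝓡 2) 𝓘(ℝ, H2) ψ p) :
    dBar C S ψ p X = (1 / 2 : ℝ) • (dBar C S ψ p X - S p (dBar C S (fun q => S q (ψ q)) p X))
      + hopfQ C S p X (ψ p) := by
  have key : ∀ Y, mvfderiv (𝓡 2) (fun q => S q (ψ q)) p Y
      = dEnd S p Y (ψ p) + S p (mvfderiv (𝓡 2) ψ p Y) := by
    intro Y
    have h1 := hS.hasMFDerivAt
    have h2 := hψ.hasMFDerivAt
    have h : HasMFDerivAt (𝓡 2) 𝓘(ℝ, H2) (fun q => toReal (S q) (ψ q)) p _ :=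
      ⟨h1.1.clm_apply h2.1, by simpa only [mfld_simps] using! h1.2.clm_apply h2.2⟩
    exact (congrArg (fun A => A Y) h.mfderiv).trans (add_comm _ _)
  have hZ' : ∀ v, S p (S p v) = -v := fun v => LinearMap.congr_fun hZ v
  have e : ∀ (r : ℝ) v, S p (r • v) = r • S p v := fun r v => (S p).map_smul_of_tower r v
  have hr : ∀ v, toReal (S p) v = S p v := fun _ => rfl
  have hs : starDEnd C S p X = dEnd S p (C.J p X) := rfl
  simp only [dBar, key, hopfQ, hs, e, map_add, hZ', map_neg, smul_apply, sub_apply,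
    ContinuousLinearMap.comp_apply, hr]
  module

/-- `S` is the mean curvature sphere of `L`: the complex structure `S : M → 𝒵` on `H = M × ℍ²`
with `S L = L`, `dS L ⊆ L`, `*δ = δ ∘ S = S ∘ δ` and `Q|_L = 0`. -/
structure IsMeanCurvatureSphere (S : M → EndH2) : Prop where
  smooth : ContMDiff (𝓡 2) 𝓘(ℝ, H2 →L[ℝ] H2) ∞ (fun q => toReal (S q))
  mem_Z : ∀ p, S p ∈ Z
  map_fiber : ∀ p, (L.fiber p).map (S p) = L.fiber p
  dS_fiber : ∀ p X, ∀ v ∈ L.fiber p, dEnd S p X v ∈ L.fiber p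
  star_delta_eq_delta_comp : ∀ p X, L.delta p (C.J p X) =
    L.delta p X ∘ₗ (S p).restrict (Submodule.map_le_iff_le_comap.mp (map_fiber p).le)
  star_delta_eq_comp_delta : ∀ p X, L.delta p (C.J p X) =
    (L.fiber p).mapQ (L.fiber p) (S p) (Submodule.map_le_iff_le_comap.mp (map_fiber p).le)
      ∘ₗ L.delta p X
  hopfQ_fiber : ∀ p X, ∀ v ∈ L.fiber p, hopfQ C S p X v = 0

end Surface

end QuaternionicCurve

end

/-!
Let `A = (1/4)(S dS + *dS)` be the companion of the Hopf field `Q = (1/4)(S dS - *dS)`. Two sections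
`dS(X̃)ψ` and `dS(Ỹ)ψ` of `L`, with `ψ` a section of `L` and `X̃`, `Ỹ` commuting vector fields, have
derivatives along `Y` and `X` that contain the same second derivative of `S`; subtracting them gives
`δ(Y) dS(X) - δ(X) dS(Y) = dS(X) δ(Y) - dS(Y) δ(X)` on `L`. For `Y = JX` the left side vanishes,
because `*δ = δS` and, as `Q|_L = 0`, `*dS = S dS` on `L`; the right side is `-4A(X) δ(X)` modulo
`L`. Thus `A(X)` maps a vector outside the line `L_p` into it, and it preserves `L_p`, so its image
lies in `L_p`. Hence `Q(X) A(X) = 0`, and since `S` anticommutes with `dS` and `*dS`, the traces of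
`Q(X) A(X)` and `S Q(X) A(X)` are the two conformality conditions.
-/

namespace QuaternionicCurve

section Trace

variable {R G : Type*} [Ring R] [AddCommGroup G] {t : R →+ G} (ht : ∀ a b, t (a * b) = t (b * a))
include ht

theorem trace_mul_self_eq_of_sub_mul_add_eq_zero {a b : R} (h : (a - b) * (a + b) = 0) :
    t (a * a) = t (b * b) := by
  have hexpand : t (a * a) + t (a * b) - t (b * a) - t (b * b) = 0 := by
    simp only [← map_add, ← map_sub]
    rw [← map_zero t, ← h]
    congr 1
    noncomm_ring
  rwa [ht a b, add_sub_cancel_right, sub_eq_zero] at hexpand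

variable [IsAddTorsionFree G] {s a b : R} (ha : s * a = -(a * s))
include ha

theorem trace_mul_mul_self_eq_zero_of_anticommute : t (s * (a * a)) = 0 := by
  rw [← self_eq_neg]
  calc t (s * (a * a)) = t (s * a * a) := by rw [mul_assoc]
    _ = -t (a * s * a) := by rw [ha, neg_mul, map_neg]
    _ = -t (s * (a * a)) := by rw [mul_assoc, ht, mul_assoc]

theorem trace_mul_mul_eq_zero_of_anticommute (hb : s * b = -(b * s))
    (h : (a - b) * (a + b) = 0) : t (s * (a * b)) = 0 := by
  have hexpand : t (s * (a * a)) + t (s * (a * b)) - t (s * (b * a)) - t (s * (b * b)) = 0 := by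
    simp only [← map_add, ← map_sub]
    rw [← map_zero t, ← mul_zero s, ← h]
    congr 1
    noncomm_ring
  rw [trace_mul_mul_self_eq_zero_of_anticommute ht ha,
    trace_mul_mul_self_eq_zero_of_anticommute ht hb, zero_add, sub_zero, sub_eq_zero] at hexpand
  rw [← self_eq_neg]
  calc t (s * (a * b)) = t (s * b * a) := by rw [hexpand, mul_assoc]
    _ = -t (b * (s * a)) := by rw [hb, neg_mul, map_neg, mul_assoc]
    _ = -t (s * (a * b)) := by rw [ht, mul_assoc]

end Trace

theorem trace_conformal_of_sub_mul_add_eq_zero {R G : Type*} [Ring R] [AddCommGroup G]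
    [IsAddTorsionFree G] {t : R →+ G} (ht : ∀ a b, t (a * b) = t (b * a)) {s b b' : R}
    (hs : s * s = -1) (hb : s * b = -(b * s)) (hb' : s * b' = -(b' * s))
    (h : (s * b - b') * (s * b + b') = 0) : t (b * b) = t (b' * b') ∧ t (b * b') = 0 := by
  have hss (a : R) : s * (s * a) = -a := by rw [← mul_assoc, hs, neg_one_mul]
  have hbs : b * s = -(s * b) := (neg_eq_iff_eq_neg.mpr hb).symm
  have hsb : s * (s * b) = -(s * b * s) := by rw [mul_assoc, hbs, mul_neg, neg_neg]
  have hsq : s * b * (s * b) = b * b := by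
    rw [mul_assoc, ← mul_assoc b, hbs, neg_mul, mul_neg, mul_assoc, hss, neg_neg]
  constructor
  · rw [← hsq]
    exact trace_mul_self_eq_of_sub_mul_add_eq_zero ht h
  · have horth := trace_mul_mul_eq_zero_of_anticommute ht hsb hb' h
    rwa [mul_assoc, hss, map_neg, neg_eq_zero] at horth

theorem traceForm_conformal_of_sub_mul_add_eq_zero {S B B' : H2 →L[ℝ] H2} (hS : S * S = -1)
    (hB : S * B = -(B * S)) (hB' : S * B' = -(B' * S))
    (h : (S * B - B') * (S * B + B') = 0) :
    traceForm B B = traceForm B' B' ∧ traceForm B B' = 0 := by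
  let t : (H2 →L[ℝ] H2) →+ ℝ :=
    (LinearMap.trace ℝ H2 ∘ₗ ContinuousLinearMap.coeLM ℝ).toAddMonoidHom
  have ht (T U : H2 →L[ℝ] H2) : t (T * U) = t (U * T) :=
    LinearMap.trace_mul_comm ℝ (T : H2 →ₗ[ℝ] H2) (U : H2 →ₗ[ℝ] H2)
  obtain ⟨hlength, horth⟩ := trace_conformal_of_sub_mul_add_eq_zero ht hS hB hB' h
  exact ⟨congrArg (1 / 8 * ·) hlength, (congrArg (1 / 8 * ·) horth).trans (mul_zero _)⟩

theorem apply_mem_of_isCoatom {R V W : Type*} [Semiring R] [AddCommMonoid V]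
    [Module R V] [AddCommMonoid W] [Module R W] {N : Submodule R V} (hN : IsCoatom N)
    {N' : Submodule R W} {T : V →ₗ[R] W} (hT : ∀ v ∈ N, T v ∈ N') {w : V} (hw : w ∉ N)
    (hTw : T w ∈ N') (v : V) : T v ∈ N' := by
  have hlt : N < N'.comap T := lt_of_le_of_ne hT fun h => hw (h ▸ hTw)
  have htop : N'.comap T = ⊤ := hN.2 _ hlt
  exact htop.ge (Submodule.mem_top (x := v))

theorem isCoatom_of_finrank_eq_add_one {K V : Type*} [DivisionRing K] [AddCommGroup V] [Module K V]
    [FiniteDimensional K V] {N : Submodule K V}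
    (h : Module.finrank K V = Module.finrank K N + 1) : IsCoatom N := by
  rw [← isSimpleModule_iff_isCoatom, isSimpleModule_iff_finrank_eq_one]
  have := N.finrank_quotient_add_finrank
  omega

theorem finrank_mulOpposite_self (K : Type*) [DivisionRing K] : Module.finrank Kᵐᵒᵖ K = 1 :=
  finrank_eq_one 1 one_ne_zero fun a => ⟨MulOpposite.op a, one_mul a⟩

section Calculus

variable {E H M F : Type*} [NormedAddCommGroup E] [NormedSpace ℝ E] [TopologicalSpace H]
  {I : ModelWithCorners ℝ E H} [TopologicalSpace M] [ChartedSpace H M]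
  [NormedAddCommGroup F] [NormedSpace ℝ F]

theorem mvfderiv_clm_apply {V W : Type*} [NormedAddCommGroup V] [NormedSpace ℝ V]
    [NormedAddCommGroup W] [NormedSpace ℝ W] {A : M → V →L[ℝ] W} {φ : M → V} {p : M}
    (hA : MDifferentiableAt I 𝓘(ℝ, V →L[ℝ] W) A p) (hφ : MDifferentiableAt I 𝓘(ℝ, V) φ p)
    (X : TangentSpace I p) :
    mvfderiv I (fun q => A q (φ q)) p X = mvfderiv I A p X (φ p) + A p (mvfderiv I φ p X) := by
  have hA' := hA.hasMFDerivAt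
  have hφ' := hφ.hasMFDerivAt
  have h : HasMFDerivAt I 𝓘(ℝ, W) (fun q => A q (φ q)) p _ :=
    ⟨hA'.1.clm_apply hφ'.1, by simpa only [mfld_simps] using! hA'.2.clm_apply hφ'.2⟩
  exact (congrArg (fun B => B X) h.mfderiv).trans (add_comm _ _)

section NormedRing

variable {R : Type*} [NormedRing R] [NormedAlgebra ℝ R] {f : M → R} {p : M}

theorem mvfderiv_mul_apply {g : M → R} (hf : MDifferentiableAt I 𝓘(ℝ, R) f p)
    (hg : MDifferentiableAt I 𝓘(ℝ, R) g p) (X : TangentSpace I p) :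
    mvfderiv I (f * g) p X = f p * mvfderiv I g p X + mvfderiv I f p X * g p :=
  congrArg (fun A => A X) (hf.hasMFDerivAt.mul' hg.hasMFDerivAt).mfderiv

theorem mul_mvfderiv_of_mul_self_eq_const (hf : MDifferentiableAt I 𝓘(ℝ, R) f p) {c : R}
    (hc : ∀ q, f q * f q = c) (X : TangentSpace I p) :
    f p * mvfderiv I f p X = -(mvfderiv I f p X * f p) := by
  have hmul := mvfderiv_mul_apply hf hf X
  rw [show f * f = fun _ => c from funext hc, mvfderiv_const] at hmul
  exact eq_neg_of_add_eq_zero_left hmul.symm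

theorem commute_mvfderiv (hf : MDifferentiableAt I 𝓘(ℝ, R) f p) {c : R}
    (hc : ∀ q, Commute c (f q)) (X : TangentSpace I p) : Commute c (mvfderiv I f p X) := by
  have hconst : MDifferentiableAt I 𝓘(ℝ, R) (fun _ => c) p := mdifferentiableAt_const
  have hleft := mvfderiv_mul_apply hconst hf X
  have hright := mvfderiv_mul_apply hf hconst X
  rw [show f * (fun _ => c) = (fun _ => c) * f from funext fun q => (hc q).symm] at hright
  rw [commute_iff_eq]
  simpa only [mvfderiv_const, zero_apply, zero_mul, mul_zero, add_zero, zero_add]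
    using hleft.symm.trans hright

end NormedRing

theorem extend_eq_mfderiv_extChartAt_symm [I.Boundaryless] [IsManifold I 1 M] {p q : M}
    (hq : q ∈ (chartAt H p).source) (X : TangentSpace I p) :
    FiberBundle.extend E X q =
      mfderiv 𝓘(ℝ, E) I (extChartAt I p).symm (extChartAt I p q) X := by
  have hX : (trivializationAt E (TangentSpace I) p ⟨p, X⟩).2 = X := by
    rw [TangentBundle.trivializationAt_apply]
    exact congrArg (fun A : E →L[ℝ] E => A X) fderivWithin_extChartAt_comp_extChartAt_symm_range
  rw [← mfderivWithin_univ, ← I.range_eq_univ, ← TangentBundle.symmL_trivializationAt hq,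
    FiberBundle.extend, hX]
  exact (Bundle.Trivialization.symmL_apply (R := ℝ) (trivializationAt E (TangentSpace I) p)
    (by simpa using hq) X).symm

theorem mvfderiv_extend [I.Boundaryless] [IsManifold I 1 M] {f : M → F} {p q : M}
    (hf : MDifferentiableAt I 𝓘(ℝ, F) f q) (hq : q ∈ (chartAt H p).source)
    (X : TangentSpace I p) :
    mvfderiv I f q (FiberBundle.extend E X q) =
      fderiv ℝ (f ∘ (extChartAt I p).symm) (extChartAt I p q) X := by
  have hq' : q ∈ (extChartAt I p).source := by rwa [extChartAt_source]
  have hsymm : MDifferentiableAt 𝓘(ℝ, E) I (extChartAt I p).symm (extChartAt I p q) := by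
    rw [← mdifferentiableWithinAt_univ, ← I.range_eq_univ]
    exact mdifferentiableWithinAt_extChartAt_symm ((extChartAt I p).map_source hq')
  have hleft := (extChartAt I p).left_inv hq'
  rw [extend_eq_mfderiv_extChartAt_symm hq, ← mfderiv_eq_fderiv,
    mfderiv_comp _ (hleft.symm ▸ hf) hsymm, hleft]
  rfl

theorem contDiffAt_comp_extChartAt_symm [I.Boundaryless] {n : WithTop ℕ∞} {f : M → F} {p : M}
    (hf : ContMDiffAt I 𝓘(ℝ, F) n f p) :
    ContDiffAt ℝ n (f ∘ (extChartAt I p).symm) (extChartAt I p p) := by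
  simpa only [extChartAt_model_space_eq_id, PartialEquiv.refl_coe, Function.id_comp,
    I.range_eq_univ, contDiffWithinAt_univ] using (contMDiffAt_iff.mp hf).2

theorem mvfderiv_extend_eventuallyEq [I.Boundaryless] [IsManifold I 2 M] {f : M → F} {p : M}
    (hf : ContMDiffAt I 𝓘(ℝ, F) 2 f p) (X : TangentSpace I p) :
    (fun q => mvfderiv I f q (FiberBundle.extend E X q)) =ᶠ[𝓝 p]
      (fun y => fderiv ℝ (f ∘ (extChartAt I p).symm) y X) ∘ extChartAt I p := by
  have : IsManifold I 1 M := .of_le one_le_two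
  filter_upwards [(chartAt H p).open_source.mem_nhds (mem_chart_source H p),
    (contMDiffAt_iff_contMDiffAt_nhds (by decide)).mp hf] with q hq hfq
  exact mvfderiv_extend (hfq.mdifferentiableAt two_ne_zero) hq X

theorem differentiableAt_fderiv_comp_extChartAt_symm [I.Boundaryless] {f : M → F} {p : M}
    (hf : ContMDiffAt I 𝓘(ℝ, F) 2 f p) :
    DifferentiableAt ℝ (fderiv ℝ (f ∘ (extChartAt I p).symm)) (extChartAt I p p) :=
  ((contDiffAt_comp_extChartAt_symm hf).fderiv_right (m := 1) (by norm_num)).differentiableAt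
    one_ne_zero

theorem mdifferentiableAt_mvfderiv_extend [I.Boundaryless] [IsManifold I 2 M] {f : M → F} {p : M}
    (hf : ContMDiffAt I 𝓘(ℝ, F) 2 f p) (X : TangentSpace I p) :
    MDifferentiableAt I 𝓘(ℝ, F) (fun q => mvfderiv I f q (FiberBundle.extend E X q)) p := by
  have hX := (differentiableAt_fderiv_comp_extChartAt_symm hf).clm_apply (differentiableAt_const X)
  have hchart := mdifferentiableAt_extChartAt (I := I) (mem_chart_source H p)
  exact (hX.comp_mdifferentiableAt hchart).congr_of_eventuallyEq
    (mvfderiv_extend_eventuallyEq hf X)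

theorem mvfderiv_mvfderiv_extend [I.Boundaryless] [IsManifold I 2 M] {f : M → F} {p : M}
    (hf : ContMDiffAt I 𝓘(ℝ, F) 2 f p) (X Y : TangentSpace I p) :
    mvfderiv I (fun q => mvfderiv I f q (FiberBundle.extend E X q)) p Y =
      fderiv ℝ (fderiv ℝ (f ∘ (extChartAt I p).symm)) (extChartAt I p p) Y X := by
  have : IsManifold I 1 M := .of_le one_le_two
  have hchart : (fun q => mvfderiv I f q (FiberBundle.extend E X q)) ∘ (extChartAt I p).symm
      =ᶠ[𝓝 (extChartAt I p p)] fun y => fderiv ℝ (f ∘ (extChartAt I p).symm) y X := by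
    have hsymm := continuousAt_extChartAt_symm (I := I) p
    rw [ContinuousAt, extChartAt_to_inv] at hsymm
    filter_upwards [hsymm.eventually (mvfderiv_extend_eventuallyEq hf X),
      extChartAt_target_mem_nhds (I := I) p] with y hy hyt
    rw [Function.comp_apply, hy, Function.comp_apply, (extChartAt I p).right_inv hyt]
  have hd := mvfderiv_extend (mdifferentiableAt_mvfderiv_extend hf X) (mem_chart_source H p) Y
  rw [FiberBundle.extend_apply_self, hchart.fderiv_eq] at hd
  exact hd.trans (congrArg (fun A : E →L[ℝ] F => A Y)
    ((ContinuousLinearMap.apply ℝ F (show E from X)).hasFDerivAt.comp _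
      (differentiableAt_fderiv_comp_extChartAt_symm hf).hasFDerivAt).fderiv)

theorem mvfderiv_mvfderiv_extend_comm [I.Boundaryless] [IsManifold I 2 M] {f : M → F} {p : M}
    (hf : ContMDiffAt I 𝓘(ℝ, F) 2 f p) (X Y : TangentSpace I p) :
    mvfderiv I (fun q => mvfderiv I f q (FiberBundle.extend E X q)) p Y =
      mvfderiv I (fun q => mvfderiv I f q (FiberBundle.extend E Y q)) p X := by
  rw [mvfderiv_mvfderiv_extend hf, mvfderiv_mvfderiv_extend hf]
  exact (contDiffAt_comp_extChartAt_symm hf).isSymmSndFDerivAt (by simp) Y X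
end Calculus

section Surface

variable {M : Type*} [TopologicalSpace M] [ChartedSpace (EuclideanSpace ℝ (Fin 2)) M]

section Differential

variable {S : M → EndH2} {p : M}
  (hS : MDifferentiableAt (𝓡 2) 𝓘(ℝ, H2 →L[ℝ] H2) (fun q => toReal (S q)) p)
include hS

theorem toReal_mul_dEnd (hZ : ∀ q, S q ∈ Z) (X : TangentSpace (𝓡 2) p) :
    toReal (S p) * dEnd S p X = -(dEnd S p X * toReal (S p)) :=
  mul_mvfderiv_of_mul_self_eq_const (f := fun q => toReal (S q)) (c := -1) hS
    (fun q => ContinuousLinearMap.ext fun v => LinearMap.congr_fun (hZ q) v) X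

theorem dEnd_smul (X : TangentSpace (𝓡 2) p) (a : (ℍ[ℝ])ᵐᵒᵖ) (v : H2) :
    dEnd S p X (a • v) = a • dEnd S p X v := by
  let scalar : H2 →L[ℝ] H2 :=
    LinearMap.toContinuousLinearMap (Module.toModuleEnd ℝ (S := (ℍ[ℝ])ᵐᵒᵖ) H2 a)
  have hcomm (q : M) : Commute scalar (toReal (S q)) :=
    ContinuousLinearMap.ext fun v => ((S q).map_smul a v).symm
  exact congrArg (fun A : H2 →L[ℝ] H2 => A v) (commute_mvfderiv hS hcomm X).symm

theorem exists_toReal_eq_dEnd (X : TangentSpace (𝓡 2) p) : ∃ A : EndH2, toReal A = dEnd S p X :=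
  ⟨{ dEnd S p X with map_smul' := dEnd_smul hS X }, rfl⟩

end Differential

namespace LineSubbundle

variable (L : LineSubbundle M) {p : M}

theorem isCoatom_fiber (p : M) : IsCoatom (L.fiber p) := by
  have hquat : Module.finrank (ℍ[ℝ])ᵐᵒᵖ ℍ[ℝ] = 1 := finrank_mulOpposite_self _
  have : Module.Finite (ℍ[ℝ])ᵐᵒᵖ ℍ[ℝ] := Module.finite_of_finrank_eq_succ hquat
  apply isCoatom_of_finrank_eq_add_one
  rw [L.fiber_eq p, finrank_span_singleton (L.frame_ne p), Module.finrank_pi_fintype]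
  simp [hquat]

theorem exists_contMDiffAt_section {v : H2} (hv : v ∈ L.fiber p) :
    ∃ ψ : M → H2, ContMDiffAt (𝓡 2) 𝓘(ℝ, H2) ∞ ψ p ∧ ψ p = v ∧ ∀ᶠ q in 𝓝 p, ψ q ∈ L.fiber q := by
  obtain ⟨U, hU, hp, hframe, hspan⟩ := L.frame_spec p
  obtain ⟨a, rfl⟩ := Submodule.mem_span_singleton.mp (L.fiber_eq p ▸ hv)
  let scalar : H2 →L[ℝ] H2 :=
    LinearMap.toContinuousLinearMap (Module.toModuleEnd ℝ (S := (ℍ[ℝ])ᵐᵒᵖ) H2 a)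
  refine ⟨fun q => a • L.frame p q, ?_, rfl, ?_⟩
  · exact scalar.contDiff.comp_contMDiffAt (hframe.contMDiffAt (hU.mem_nhds hp))
  · filter_upwards [hU.mem_nhds hp] with q hq
    rw [(hspan q hq).2]
    exact Submodule.smul_mem _ a (Submodule.mem_span_singleton_self _)

end LineSubbundle

variable [IsManifold (𝓡 2) ∞ M]

/-- The derivative of `S` along the vector field that extends `X ∈ T_pM` with constant coefficients
in the preferred chart at `p`. Such fields commute, which makes its derivatives symmetric. -/
noncomputable def dEndExtend (S : M → EndH2) {p : M} (X : TangentSpace (𝓡 2) p) (q : M) :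
    H2 →L[ℝ] H2 :=
  dEnd S q (FiberBundle.extend (EuclideanSpace ℝ (Fin 2)) X q)

theorem dEndExtend_self (S : M → EndH2) {p : M} (X : TangentSpace (𝓡 2) p) :
    dEndExtend S X p = dEnd S p X :=
  congrArg (dEnd S p) (FiberBundle.extend_apply_self _ X)

section SecondDerivative

variable {L : LineSubbundle M} {S : M → EndH2} {p : M}
  (hS : ContMDiffAt (𝓡 2) 𝓘(ℝ, H2 →L[ℝ] H2) 2 (fun q => toReal (S q)) p)
include hS

theorem mvfderiv_dEndExtend_comm (X Y : TangentSpace (𝓡 2) p) :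
    mvfderiv (𝓡 2) (dEndExtend S X) p Y = mvfderiv (𝓡 2) (dEndExtend S Y) p X :=
  mvfderiv_mvfderiv_extend_comm hS X Y

variable (hL : ∀ q X, ∀ v ∈ L.fiber q, dEnd S q X v ∈ L.fiber q)

theorem delta_dEnd {ψ : M → H2} (hψ : MDifferentiableAt (𝓡 2) 𝓘(ℝ, H2) ψ p)
    (hψL : ∀ᶠ q in 𝓝 p, ψ q ∈ L.fiber q) (X Y : TangentSpace (𝓡 2) p) :
    L.delta p Y ⟨dEnd S p X (ψ p), hL p X _ hψL.self_of_nhds⟩ = (L.fiber p).mkQ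
      (mvfderiv (𝓡 2) (dEndExtend S X) p Y (ψ p) + dEnd S p X (mvfderiv (𝓡 2) ψ p Y)) := by
  have hdS : MDifferentiableAt (𝓡 2) 𝓘(ℝ, H2 →L[ℝ] H2) (dEndExtend S X) p :=
    mdifferentiableAt_mvfderiv_extend hS X
  have hdelta := L.delta_apply p Y (fun q => dEndExtend S X q (ψ q)) (hdS.clm_apply hψ)
    (hψL.mono fun q => hL q _ _)
  rw [mvfderiv_clm_apply hdS hψ] at hdelta
  simpa only [dEndExtend_self] using hdelta

theorem mkQ_dEnd_sub_dEnd {v x y : H2} (hv : v ∈ L.fiber p) {X Y : TangentSpace (𝓡 2) p}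
    (hx : L.delta p X ⟨v, hv⟩ = (L.fiber p).mkQ x)
    (hy : L.delta p Y ⟨v, hv⟩ = (L.fiber p).mkQ y) :
    (L.fiber p).mkQ (dEnd S p X y - dEnd S p Y x) =
      L.delta p Y ⟨dEnd S p X v, hL p X v hv⟩ - L.delta p X ⟨dEnd S p Y v, hL p Y v hv⟩ := by
  obtain ⟨ψ, hψs, rfl, hψL⟩ := L.exists_contMDiffAt_section hv
  have hψ : MDifferentiableAt (𝓡 2) 𝓘(ℝ, H2) ψ p := hψs.mdifferentiableAt (by simp)
  have hmod {T : TangentSpace (𝓡 2) p} {t : H2} (U : TangentSpace (𝓡 2) p)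
      (ht : L.delta p T ⟨ψ p, hv⟩ = (L.fiber p).mkQ t) :
      (L.fiber p).mkQ (dEnd S p U (mvfderiv (𝓡 2) ψ p T)) = (L.fiber p).mkQ (dEnd S p U t) := by
    rw [L.delta_apply p T ψ hψ hψL] at ht
    have hmem := hL p U _ ((Submodule.Quotient.eq _).mp ht)
    rw [map_sub] at hmem
    exact (Submodule.Quotient.eq _).mpr hmem
  rw [delta_dEnd hS hL hψ hψL, delta_dEnd hS hL hψ hψL, mvfderiv_dEndExtend_comm hS X Y,
    map_add, map_add, hmod X hy, hmod Y hx, map_sub, add_sub_add_left_eq_sub]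

end SecondDerivative

/-- The Hopf field `A = (1/4)(S dS + *dS)`, the companion of `Q = hopfQ`. -/
noncomputable def hopfA (C : ComplexStructure M) (S : M → EndH2) (p : M)
    (X : TangentSpace (𝓡 2) p) : H2 →L[ℝ] H2 :=
  (1 / 4 : ℝ) • ((toReal (S p)).comp (dEnd S p X) + starDEnd C S p X)

namespace IsMeanCurvatureSphere

variable {C : ComplexStructure M} {L : LineSubbundle M} {S : M → EndH2}
  (hS : IsMeanCurvatureSphere C L S) {p : M}
include hS

theorem apply_mem_fiber {v : H2} (hv : v ∈ L.fiber p) : S p v ∈ L.fiber p :=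
  (hS.map_fiber p).le (Submodule.mem_map_of_mem hv)

theorem mdifferentiableAt (p : M) :
    MDifferentiableAt (𝓡 2) 𝓘(ℝ, H2 →L[ℝ] H2) (fun q => toReal (S q)) p :=
  (hS.smooth p).mdifferentiableAt (by simp)

theorem starDEnd_apply {v : H2} (hv : v ∈ L.fiber p) (X : TangentSpace (𝓡 2) p) :
    starDEnd C S p X v = S p (dEnd S p X v) := by
  have hQ : (1 / 4 : ℝ) • (S p (dEnd S p X v) - starDEnd C S p X v) = 0 :=
    hS.hopfQ_fiber p X v hv
  exact (sub_eq_zero.mp ((smul_eq_zero.mp hQ).resolve_left (by norm_num))).symm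

theorem delta_J_apply {v x : H2} (hv : v ∈ L.fiber p) {X : TangentSpace (𝓡 2) p}
    (hx : L.delta p X ⟨v, hv⟩ = (L.fiber p).mkQ x) :
    L.delta p (C.J p X) ⟨v, hv⟩ = (L.fiber p).mkQ (S p x) := by
  rw [hS.star_delta_eq_comp_delta, LinearMap.comp_apply, hx]
  rfl

theorem hopfA_apply_mem_fiber {v : H2} (hv : v ∈ L.fiber p) (X : TangentSpace (𝓡 2) p) :
    hopfA C S p X v ∈ L.fiber p :=
  (L.fiber p).smul_of_tower_mem (1 / 4 : ℝ) <| (L.fiber p).add_mem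
    (hS.apply_mem_fiber (hS.dS_fiber p X v hv)) (hS.dS_fiber p (C.J p X) v hv)

theorem hopfA_mem_of_delta_eq_mkQ {v w : H2} (hv : v ∈ L.fiber p) {X : TangentSpace (𝓡 2) p}
    (hw : L.delta p X ⟨v, hv⟩ = (L.fiber p).mkQ w) : hopfA C S p X w ∈ L.fiber p := by
  have hcurl := mkQ_dEnd_sub_dEnd ((hS.smooth p).of_le ENat.LEInfty.out) hS.dS_fiber hv hw
    (hS.delta_J_apply hv hw)
  have hclosed : L.delta p (C.J p X) ⟨dEnd S p X v, hS.dS_fiber p X v hv⟩ =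
      L.delta p X ⟨dEnd S p (C.J p X) v, hS.dS_fiber p _ v hv⟩ := by
    rw [hS.star_delta_eq_delta_comp]
    exact congrArg (L.delta p X) (Subtype.ext (hS.starDEnd_apply hv X).symm)
  have hanti : dEnd S p X (S p w) = -S p (dEnd S p X w) :=
    congrArg (fun T : H2 →L[ℝ] H2 => T w)
      (neg_eq_iff_eq_neg.mpr (toReal_mul_dEnd (hS.mdifferentiableAt p) hS.mem_Z X)).symm
  rw [hclosed, sub_self, hanti, ← neg_add', map_neg, neg_eq_zero, Submodule.mkQ_apply,
    Submodule.Quotient.mk_eq_zero] at hcurl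
  exact (L.fiber p).smul_of_tower_mem (1 / 4 : ℝ) hcurl

theorem exists_toReal_eq_hopfA (X : TangentSpace (𝓡 2) p) :
    ∃ A : EndH2, toReal A = hopfA C S p X := by
  obtain ⟨B, hB⟩ := exists_toReal_eq_dEnd (hS.mdifferentiableAt p) X
  obtain ⟨B', hB'⟩ := exists_toReal_eq_dEnd (hS.mdifferentiableAt p) (C.J p X)
  refine ⟨(1 / 4 : ℝ) • (S p * B + B'), ?_⟩
  rw [hopfA, starDEnd, ContinuousLinearMap.comp_apply, ← hB, ← hB']
  rfl

theorem hopfA_mem_fiber {X : TangentSpace (𝓡 2) p} (hX : L.delta p X ≠ 0) (w : H2) :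
    hopfA C S p X w ∈ L.fiber p := by
  obtain ⟨⟨v, hv⟩, hδ⟩ := DFunLike.ne_iff.mp hX
  obtain ⟨x, hx⟩ := (L.fiber p).mkQ_surjective (L.delta p X ⟨v, hv⟩)
  have hxL : x ∉ L.fiber p := fun hmem =>
    hδ (hx.symm.trans ((Submodule.Quotient.mk_eq_zero _).mpr hmem))
  obtain ⟨A, hA⟩ := hS.exists_toReal_eq_hopfA X
  have hAu (u : H2) : hopfA C S p X u = A u := by rw [← hA]; rfl
  have hAL (u : H2) (hu : u ∈ L.fiber p) : A u ∈ L.fiber p :=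
    hAu u ▸ hS.hopfA_apply_mem_fiber hu X
  have hAx : A x ∈ L.fiber p := hAu x ▸ hS.hopfA_mem_of_delta_eq_mkQ hv hx.symm
  rw [hAu]
  exact apply_mem_of_isCoatom (L.isCoatom_fiber p) hAL hxL hAx w

theorem hopfQ_mul_hopfA {X : TangentSpace (𝓡 2) p} (hX : L.delta p X ≠ 0) :
    hopfQ C S p X * hopfA C S p X = 0 :=
  ContinuousLinearMap.ext fun w => hS.hopfQ_fiber p X _ (hS.hopfA_mem_fiber hX w)

end IsMeanCurvatureSphere

end Surface

end QuaternionicCurve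

open QuaternionicCurve in
theorem mainTheorem11_general {M : Type*} [TopologicalSpace M]
    [ChartedSpace (EuclideanSpace ℝ (Fin 2)) M] [IsManifold (𝓡 2) ∞ M]
    {C : ComplexStructure M} {L : LineSubbundle M} {S : M → EndH2}
    (hS : IsMeanCurvatureSphere C L S) {p : M} (himm : Function.Injective (L.delta p))
    (X : TangentSpace (𝓡 2) p) :
    traceForm (dEnd S p X) (dEnd S p X) = traceForm (starDEnd C S p X) (starDEnd C S p X) ∧
      traceForm (dEnd S p X) (starDEnd C S p X) = 0 := by
  have hanti := toReal_mul_dEnd (hS.mdifferentiableAt p) hS.mem_Z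
  refine traceForm_conformal_of_sub_mul_add_eq_zero (S := toReal (S p))
    (ContinuousLinearMap.ext fun v => LinearMap.congr_fun (hS.mem_Z p) v)
    (hanti X) (hanti (C.J p X)) ?_
  obtain rfl | hX := eq_or_ne X 0
  · simp
  · have hδ : L.delta p X ≠ 0 := (map_ne_zero_iff _ himm).mpr hX
    have hQA := hS.hopfQ_mul_hopfA hδ
    rw [hopfQ, hopfA, ContinuousLinearMap.mul_def, ContinuousLinearMap.smul_comp,
      ContinuousLinearMap.comp_smul, smul_smul] at hQA
    exact (smul_eq_zero.mp hQA).resolve_left (by norm_num)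

open QuaternionicCurve in
theorem mainTheorem11 {M : Type*} [TopologicalSpace M]
    [ChartedSpace (EuclideanSpace ℝ (Fin 2)) M] [IsManifold (𝓡 2) ∞ M]
    (C : ComplexStructure M) (L : LineSubbundle M)
    (hhol : IsHolomorphicCurve C L) (himm : IsImmersed L)
    (S : M → EndH2) (hS : IsMeanCurvatureSphere C L S) (p : M) (X : TangentSpace (𝓡 2) p) :
    traceForm (dEnd S p X) (dEnd S p X) = traceForm (starDEnd C S p X) (starDEnd C S p X) ∧
      traceForm (dEnd S p X) (starDEnd C S p X) = 0 :=
  mainTheorem11_general hS (himm p) X
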